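/- **Theorem.** *Outer commutator words* are defined recursively: every single variable is an outer commutator word, and if $\alpha$ and $\beta$ are outer commutator words having no variable in common, then $[\alpha,\beta]$ is an outer commutator word, where $[a,b]=aba^{-1}b^{-1}$. For a word $w=w(x_1,\dots,x_r)$ and a tuple $\mathbf S=(S_1,\dots,S_r)$ of subsets of a group $G$, let $w\{\mathbf S\}$ be the set of all values $w(g_1,\dots,g_r)$ with $g_i\in S_i$ for all $i$, and let $w(\mathbf S)$ be the subgroup of $G$ generated by $w\{\mathbf S\}$. A subset of $G$ is *normal* if it is closed under conjugation by the elements of $G$. There is a function $f$ such that the following holds for every integer $r\ge 1$, every outer commutator word $w$ in the variables $x_1,\dots,x_r$ (each of which occurs in $w$), and every group $G$. Let $\mathbf N=(N_1,\dots,N_r)$ be a tuple of normal subgroups of $G$, let $\mathbf S=(S_1,\dots,S_r)$ be a tuple of subsets of $G$, and suppose that for every $i=1,\dots,r$ 1. $N_i=\langle S_i\rangle$ and $S_i$ is a normal subset of $G$; 2. $n_i\ge 1$ is an integer such that $x^{n_i}\in S_i$ for all $x\in N_i$. If the set $w\{\mathbf S\}$ is finite, of cardinality $m$, then the subgroup $w(\mathbf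 N)$ is finite and $$|w(\mathbf N)|\le f(m,r,n_1,\dots,n_r).$$ -/

import Mathlib

/-- `IsOuterCommutatorWord V w`: the element `w` of the free group on `X` is an outer commutator
word, and `V` is the set of variables that it uses.  A single variable is an outer commutator word;
if `α` and `β` are outer commutator words in different variables, then so is their commutator
`[α, β] = α β α⁻¹ β⁻¹`. -/
inductive IsOuterCommutatorWord {X : Type*} : Set X → FreeGroup X → Prop
  | var (x : X) : IsOuterCommutatorWord {x} (FreeGroup.of x)
  | comm {U V : Set X} {α β : FreeGroup X} :
      IsOuterCommutatorWord U α → IsOuterCommutatorWord V β → Disjoint U V →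
        IsOuterCommutatorWord (U ∪ V) (α * β * α⁻¹ * β⁻¹)

/-- `w{S}`: the set of all values `w(g_1, …, g_r)` with `g_i ∈ S_i` for every `i`. -/
def wordValues {X G : Type*} [Group G] (w : FreeGroup X) (S : X → Set G) : Set G :=
  {a | ∃ g : X → G, (∀ i, g i ∈ S i) ∧ FreeGroup.lift g w = a}

/-- `w(S)`: the subgroup generated by `w{S}`. -/
def wordSubgroup {X G : Type*} [Group G] (w : FreeGroup X) (S : X → Set G) : Subgroup G :=
  Subgroup.closure (wordValues w S)

/-- A normal subset of a group: a subset that is closed under conjugation. -/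
def IsNormalSubset {G : Type*} [Group G] (S : Set G) : Prop :=
  ∀ s ∈ S, ∀ g : G, g * s * g⁻¹ ∈ S

/-! Let W = w(**N**). Since the S_i are normal sets, W is generated by the normal set w{**S**} of m
elements. The commutator of two elements of W depends only on their conjugation actions on w{**S**},
so W has boundedly many commutators, and a quantitative form of Schur's theorem bounds |W'|. As W/W'
is abelian with m generators, it remains to bound its exponent; passing to G/W', W may be taken
abelian (`exists_pow_eq_one`).

For abelian W, fix a value w(g) and an index l. The elements g_l^(n_l a) lie in S_l, so for a = 0,
1, 2, ... the values of w with g_l replaced by g_l^(n_l a) range over a set of bounded size, and two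
of them coincide. If w were multiplicative in the l-th entry, a bounded power of w(g) would be
trivial. It is multiplicative modulo the commutators in which another entry K_i is replaced by [K_i,
K_l] (`mk_eval_update_mul`), so it suffices to bound the exponent of these error terms.

That is an induction (`annihilates_step`). Entries indexed by a subset P of Q lie in the c-th
derived subgroup of I, the intersection of the N_j with j in Q. An error at i outside Q puts the new
entry in the intersection over Q ∪ {i}; an error at i in Q but not in P enlarges P; an error at i in
P raises c. Q and P are bounded. Once c is large, the three subgroups lemma covers everything by
terms with an entry [N_i, I], i outside Q, and Q grows again (`subgroup_update_derivedSubgroup_le`).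
New entries are iterated quotients of elements of S_i; values on these are iterated quotients of
values on S, so their number stays bounded (`values_iterate_quotients`). -/

section

open Function Subgroup
open scoped commutatorElement

universe u

/-! ### The three subgroups lemma modulo a normal subgroup -/

namespace Subgroup

variable {G : Type*} [Group G]

/-- The largest subgroup whose commutator with `B` is contained in `M`. -/
def residual (M B : Subgroup G) [M.Normal] : Subgroup G :=
  (centralizer (B.map (QuotientGroup.mk' M) : Set (G ⧸ M))).comap (QuotientGroup.mk' M)

theorem commutator_le_iff_map_eq_bot {M A B : Subgroup G} [M.Normal] :
    ⁅A, B⁆ ≤ M ↔ ⁅A.map (QuotientGroup.mk' M), B.map (QuotientGroup.mk' M)⁆ = ⊥ := by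
  rw [← map_commutator, map_eq_bot_iff, QuotientGroup.ker_mk']

theorem le_residual_iff {M A B : Subgroup G} [M.Normal] : A ≤ residual M B ↔ ⁅A, B⁆ ≤ M := by
  rw [commutator_le_iff_map_eq_bot, commutator_eq_bot_iff_le_centralizer, map_le_iff_le_comap]
  rfl

instance residual_normal (M B : Subgroup G) [M.Normal] [B.Normal] : (residual M B).Normal := by
  have : (B.map (QuotientGroup.mk' M)).Normal :=
    Normal.map inferInstance _ (QuotientGroup.mk'_surjective M)
  unfold residual
  infer_instance

/-- The three subgroups lemma modulo a normal subgroup. -/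
theorem commutator_commutator_le_of_rotate {M A B C : Subgroup G} [M.Normal]
    (h₁ : ⁅⁅B, C⁆, A⁆ ≤ M) (h₂ : ⁅⁅C, A⁆, B⁆ ≤ M) : ⁅⁅A, B⁆, C⁆ ≤ M := by
  rw [commutator_le_iff_map_eq_bot, map_commutator] at *
  exact commutator_commutator_eq_bot_of_rotate h₁ h₂

theorem commutator_commutator_right_le {M X A B : Subgroup G} [M.Normal]
    (h₁ : ⁅⁅X, A⁆, B⁆ ≤ M) (h₂ : ⁅⁅X, B⁆, A⁆ ≤ M) : ⁅X, ⁅A, B⁆⁆ ≤ M := by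
  rw [commutator_comm X]
  refine commutator_commutator_le_of_rotate ?_ h₁
  rwa [commutator_comm B X]

theorem commutator_self_le_commutator_commutator (Y B : Subgroup G) [Y.Normal] [B.Normal] :
    ⁅⁅Y, Y⁆, B⁆ ≤ ⁅Y, ⁅Y, B⁆⁆ := by
  rw [commutator_comm _ B, commutator_comm Y ⁅Y, B⁆]
  exact commutator_commutator_right_le (by rw [commutator_comm B]) (by rw [commutator_comm B])

end Subgroup

/-! ### Outer commutators as trees -/

/-- A binary tree with labelled leaves, which describes an outer commutator. -/
inductive CommutatorTree (X : Type*)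
  | leaf (x : X) : CommutatorTree X
  | node (a b : CommutatorTree X) : CommutatorTree X

namespace CommutatorTree

variable {X G : Type*} [Group G]

/-- The set of labels of the leaves. -/
def leaves : CommutatorTree X → Set X
  | leaf x => {x}
  | node a b => a.leaves ∪ b.leaves

/-- No label occurs twice. -/
def IsLinear : CommutatorTree X → Prop
  | leaf _ => True
  | node a b => a.IsLinear ∧ b.IsLinear ∧ Disjoint a.leaves b.leaves

/-- The length of the longest branch. -/
def height : CommutatorTree X → ℕ
  | leaf _ => 0
  | node a b => max a.height b.height + 1

/-- The number of leaves. -/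
def size : CommutatorTree X → ℕ
  | leaf _ => 1
  | node a b => a.size + b.size

/-- The iterated commutator of group elements. -/
def eval (g : X → G) : CommutatorTree X → G
  | leaf x => g x
  | node a b => ⁅a.eval g, b.eval g⁆

/-- The iterated commutator of subgroups. -/
def subgroup (K : X → Subgroup G) : CommutatorTree X → Subgroup G
  | leaf x => K x
  | node a b => ⁅a.subgroup K, b.subgroup K⁆

/-- The set of all iterated commutators of elements of given sets. -/
def values (T : X → Set G) : CommutatorTree X → Set G
  | leaf x => T x
  | node a b => Set.image2 (fun x y => ⁅x, y⁆) (a.values T) (b.values T)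

theorem leaves_nonempty : ∀ t : CommutatorTree X, t.leaves.Nonempty
  | leaf x => Set.singleton_nonempty x
  | node a _ => a.leaves_nonempty.inl

theorem height_lt_size : ∀ t : CommutatorTree X, t.height < t.size
  | leaf _ => Nat.zero_lt_one
  | node a b => by
    have := a.height_lt_size
    have := b.height_lt_size
    simp only [height, size]
    omega

theorem size_eq_ncard : ∀ t : CommutatorTree X, t.IsLinear →
    t.leaves.Finite ∧ t.size = t.leaves.ncard
  | leaf x, _ => ⟨Set.finite_singleton x, (Set.ncard_singleton x).symm⟩
  | node a b, h => by
    obtain ⟨fa, ha⟩ := a.size_eq_ncard h.1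
    obtain ⟨fb, hb⟩ := b.size_eq_ncard h.2.1
    refine ⟨fa.union fb, ?_⟩
    simp only [size, leaves]
    rw [Set.ncard_union_eq h.2.2 fa fb, ha, hb]

theorem eval_congr {g h : X → G} : ∀ {t : CommutatorTree X}, (∀ i ∈ t.leaves, g i = h i) →
    t.eval g = t.eval h
  | leaf x, H => H x rfl
  | node a b, H => by
    simp only [eval]
    rw [a.eval_congr fun i hi => H i (.inl hi), b.eval_congr fun i hi => H i (.inr hi)]

theorem subgroup_congr {K L : X → Subgroup G} : ∀ {t : CommutatorTree X},
    (∀ i ∈ t.leaves, K i = L i) → t.subgroup K = t.subgroup L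
  | leaf x, H => H x rfl
  | node a b, H => by
    simp only [subgroup]
    rw [a.subgroup_congr fun i hi => H i (.inl hi), b.subgroup_congr fun i hi => H i (.inr hi)]

theorem subgroup_mono {K L : X → Subgroup G} (h : ∀ i, K i ≤ L i) :
    ∀ t : CommutatorTree X, t.subgroup K ≤ t.subgroup L
  | leaf x => h x
  | node a b => commutator_mono (a.subgroup_mono h) (b.subgroup_mono h)

theorem subgroup_normal {K : X → Subgroup G} (h : ∀ i, (K i).Normal) :
    ∀ t : CommutatorTree X, (t.subgroup K).Normal
  | leaf x => h x
  | node a b => by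
    have := a.subgroup_normal h
    have := b.subgroup_normal h
    exact commutator_normal _ _

theorem map_subgroup {H : Type*} [Group H] (φ : G →* H) (K : X → Subgroup G) :
    ∀ t : CommutatorTree X, (t.subgroup K).map φ = t.subgroup fun i => (K i).map φ
  | leaf _ => rfl
  | node a b => by
    simp only [subgroup]
    rw [map_commutator, a.map_subgroup, b.map_subgroup]

theorem map_eval {H : Type*} [Group H] (φ : G →* H) (g : X → G) :
    ∀ t : CommutatorTree X, φ (t.eval g) = t.eval fun i => φ (g i)
  | leaf _ => rfl
  | node a b => by
    simp only [eval]
    rw [map_commutatorElement, a.map_eval, b.map_eval]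

theorem image_values {H : Type*} [Group H] (φ : G →* H) (T : X → Set G) :
    ∀ t : CommutatorTree X, φ '' t.values T = t.values fun i => φ '' T i
  | leaf _ => rfl
  | node a b => by
    simp only [values]
    rw [← a.image_values, ← b.image_values]
    exact Set.image_image2_distrib fun x y => map_commutatorElement φ x y

theorem values_mono {S T : X → Set G} (h : ∀ i, S i ⊆ T i) :
    ∀ t : CommutatorTree X, t.values S ⊆ t.values T
  | leaf x => h x
  | node a b => Set.image2_subset (a.values_mono h) (b.values_mono h)

theorem eval_mem_values {T : X → Set G} {g : X → G} (h : ∀ i, g i ∈ T i) :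
    ∀ t : CommutatorTree X, t.eval g ∈ t.values T
  | leaf x => h x
  | node a b => Set.mem_image2_of_mem (a.eval_mem_values h) (b.eval_mem_values h)

theorem eval_mem_subgroup {K : X → Subgroup G} {g : X → G} (h : ∀ i, g i ∈ K i) :
    ∀ t : CommutatorTree X, t.eval g ∈ t.subgroup K
  | leaf x => h x
  | node a b => commutator_mem_commutator (a.eval_mem_subgroup h) (b.eval_mem_subgroup h)

-- In a linear tree the two branches use disjoint variables, so assignments chosen for each glue
-- together. Nonemptiness supplies values for the variables that do not occur.
open Classical in
theorem exists_eval_eq_of_mem_values {T : X → Set G} (hT : ∀ i, (T i).Nonempty) :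
    ∀ {t : CommutatorTree X}, t.IsLinear → ∀ {v : G}, v ∈ t.values T →
      ∃ g : X → G, (∀ i, g i ∈ T i) ∧ t.eval g = v
  | leaf x, _, v, hv => by
    choose h hh using hT
    refine ⟨update h x v, fun i => ?_, by simp [eval]⟩
    rcases eq_or_ne i x with rfl | hi
    · simpa [values] using hv
    · simpa [hi] using hh i
  | node a b, ht, v, hv => by
    obtain ⟨p, hp, q, hq, rfl⟩ := hv
    obtain ⟨g, hg, rfl⟩ := exists_eval_eq_of_mem_values hT ht.1 hp
    obtain ⟨h, hh, rfl⟩ := exists_eval_eq_of_mem_values hT ht.2.1 hq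
    refine ⟨fun i => if i ∈ a.leaves then g i else h i, fun i => ?_, ?_⟩
    · dsimp only
      split_ifs
      exacts [hg i, hh i]
    · simp only [eval]
      rw [eval_congr (t := a) (h := g) fun i hi => if_pos hi,
        eval_congr (t := b) (h := h) fun i hi => if_neg (Set.disjoint_right.1 ht.2.2 hi)]

/-- An iterated commutator is contained in the subgroup of each of its leaves. -/
theorem subgroup_le {K : X → Subgroup G} (h : ∀ i, (K i).Normal) {l : X} :
    ∀ {t : CommutatorTree X}, l ∈ t.leaves → t.subgroup K ≤ K l
  | leaf x, hl => by rw [Set.mem_singleton_iff.1 hl]; exact le_rfl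
  | node a b, hl => by
    have := a.subgroup_normal h
    have := b.subgroup_normal h
    rcases hl with hl | hl
    · exact (commutator_le_left _ _).trans (subgroup_le h hl)
    · exact (commutator_le_right _ _).trans (subgroup_le h hl)

variable [DecidableEq X]

theorem update_normal {K : X → Subgroup G} (hK : ∀ i, (K i).Normal) (l : X) (E : Subgroup G)
    [hE : E.Normal] (i : X) : (update K l E i).Normal := by
  rcases eq_or_ne i l with rfl | hi
  · simpa using hE
  · simpa [hi] using hK i

theorem subgroup_update_of_notMem {K : X → Subgroup G} {l : X} {E : Subgroup G}
    {t : CommutatorTree X} (h : l ∉ t.leaves) : t.subgroup (update K l E) = t.subgroup K :=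
  subgroup_congr fun _ hi => update_of_ne (ne_of_mem_of_not_mem hi h) _ _

theorem eval_update_of_notMem {g : X → G} {l : X} {x : G}
    {t : CommutatorTree X} (h : l ∉ t.leaves) : t.eval (update g l x) = t.eval g :=
  eval_congr fun _ hi => update_of_ne (ne_of_mem_of_not_mem hi h) _ _

/-- Commutation with a normal subgroup distributes over the leaves of a tree. -/
theorem commutator_subgroup_le {K : X → Subgroup G} (hK : ∀ i, (K i).Normal) (E : Subgroup G)
    [E.Normal] : ∀ {t : CommutatorTree X}, t.IsLinear → ∀ (M : Subgroup G) [M.Normal],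
      (∀ l ∈ t.leaves, t.subgroup (update K l ⁅K l, E⁆) ≤ M) → ⁅E, t.subgroup K⁆ ≤ M
  | leaf x, _, M, _, h => by
    have := h x rfl
    rw [commutator_comm]
    simpa [subgroup] using this
  | node a b, ht, M, _, h => by
    have := a.subgroup_normal hK
    have := b.subgroup_normal hK
    -- The three subgroups lemma moves `E` into one branch at a time; `residual` absorbs the other
    -- branch into the target of the recursion.
    refine commutator_commutator_right_le ?_ ?_
    · rw [← le_residual_iff]
      refine commutator_subgroup_le hK E ht.1 _ fun l hl => ?_
      rw [le_residual_iff]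
      have := h l (.inl hl)
      rwa [subgroup, subgroup_update_of_notMem (t := b) (Set.disjoint_left.1 ht.2.2 hl)] at this
    · rw [← le_residual_iff]
      refine commutator_subgroup_le hK E ht.2.1 _ fun l hl => ?_
      rw [le_residual_iff, commutator_comm]
      have := h l (.inr hl)
      rwa [subgroup, subgroup_update_of_notMem (t := a) (Set.disjoint_right.1 ht.2.2 hl)] at this

end CommutatorTree

/-! ### Commutators modulo a normal subgroup, derived series, intersections -/

section

variable {G : Type*} [Group G]

theorem commute_mk_of_commutator_mem {M : Subgroup G} [M.Normal] {x y : G} (h : ⁅x, y⁆ ∈ M) :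
    Commute (x : G ⧸ M) (y : G ⧸ M) := by
  rw [← commutatorElement_eq_one_iff_commute]
  have := (QuotientGroup.eq_one_iff (N := M) _).2 h
  simpa [commutatorElement_def] using this

theorem commutatorElement_mul_mul_eq {p q s b : G} (h₁ : Commute s b) (h₂ : Commute p ⁅q, b⁆)
    (h₃ : Commute ⁅p, b⁆ ⁅q, b⁆) : ⁅p * q * s, b⁆ = ⁅p, b⁆ * ⁅q, b⁆ := by
  rw [commutatorElement_mul_left_eq_conj_mul, h₁.commutator_eq,
    commutatorElement_mul_left_eq_conj_mul, h₂.eq, h₃.eq]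
  group

/-- The inductive step for multiplicativity. `P` differs from `p * q` by a factor that commutes with
`b` modulo `M` and drops out; in ⁅pq, b⁆ = p⁅q, b⁆p⁻¹⁅p, b⁆ the conjugation is trivial modulo `M` by
`h`. That the two factors commute serves the mirrored case, which inverts both sides. -/
theorem mk_commutatorElement_mul {M A B : Subgroup G} [M.Normal] [A.Normal] [B.Normal]
    (h : ⁅A, ⁅A, B⁆⁆ ≤ M) {P p q b : G} (hp : p ∈ A) (hq : q ∈ A) (hb : b ∈ B)
    (hP : (P : G ⧸ residual M B) = p * q) :
    ((⁅P, b⁆ : G) : G ⧸ M) = (⁅p, b⁆ : G) * (⁅q, b⁆ : G) ∧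
      Commute ((⁅p, b⁆ : G) : G ⧸ M) ((⁅q, b⁆ : G) : G ⧸ M) := by
  obtain ⟨s, hs, rfl⟩ : ∃ s ∈ residual M B, P = p * q * s := by
    refine ⟨(p * q)⁻¹ * P, ?_, by group⟩
    rw [← QuotientGroup.mk_mul, eq_comm, QuotientGroup.eq] at hP
    exact hP
  have hqb : ⁅q, b⁆ ∈ ⁅A, B⁆ := commutator_mem_commutator hq hb
  have h₁ : Commute (s : G ⧸ M) (b : G ⧸ M) :=
    commute_mk_of_commutator_mem (le_residual_iff.1 le_rfl (commutator_mem_commutator hs hb))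
  have h₂ : Commute (p : G ⧸ M) ((⁅q, b⁆ : G) : G ⧸ M) :=
    commute_mk_of_commutator_mem (h (commutator_mem_commutator hp hqb))
  have h₃ : Commute ((⁅p, b⁆ : G) : G ⧸ M) ((⁅q, b⁆ : G) : G ⧸ M) :=
    commute_mk_of_commutator_mem (h (commutator_mem_commutator
      (commutator_le_left A B (commutator_mem_commutator hp hb)) hqb))
  have hc (x y : G) : ((⁅x, y⁆ : G) : G ⧸ M) = ⁅(x : G ⧸ M), (y : G ⧸ M)⁆ :=
    map_commutatorElement (QuotientGroup.mk' M) x y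
  refine ⟨?_, h₃⟩
  simp only [hc, QuotientGroup.mk_mul] at *
  exact commutatorElement_mul_mul_eq h₁ h₂ h₃

/-- The derived series of a subgroup, as subgroups of the ambient group. -/
def derivedSubgroup (A : Subgroup G) : ℕ → Subgroup G
  | 0 => A
  | c + 1 => ⁅derivedSubgroup A c, derivedSubgroup A c⁆

instance derivedSubgroup_normal (A : Subgroup G) [A.Normal] : ∀ c, (derivedSubgroup A c).Normal
  | 0 => ‹_›
  | c + 1 => by
    have := derivedSubgroup_normal A c
    exact commutator_normal _ _

theorem derivedSubgroup_antitone (A : Subgroup G) [A.Normal] : Antitone (derivedSubgroup A) :=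
  antitone_nat_of_succ_le fun _ => commutator_le_left _ _

theorem commutator_derivedSubgroup_succ_le (A B : Subgroup G) [A.Normal] [B.Normal] (c : ℕ) :
    ⁅derivedSubgroup A (c + 1), B⁆ ≤ ⁅derivedSubgroup A c, ⁅derivedSubgroup A c, B⁆⁆ :=
  commutator_self_le_commutator_commutator _ _

/-- The intersection of the members of a family of subgroups with indices in `Q`. -/
def interOf {X : Type*} (N : X → Subgroup G) (Q : Finset X) : Subgroup G :=
  ⨅ i : Q, N i

theorem interOf_le {X : Type*} {N : X → Subgroup G} {Q : Finset X} {i : X} (hi : i ∈ Q) :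
    interOf N Q ≤ N i :=
  iInf_le (fun i : Q => N i) ⟨i, hi⟩

theorem le_interOf_iff {X : Type*} {N : X → Subgroup G} {Q : Finset X} {E : Subgroup G} :
    E ≤ interOf N Q ↔ ∀ i ∈ Q, E ≤ N i := by
  simp [interOf, le_iInf_iff]

theorem interOf_normal {X : Type*} {N : X → Subgroup G} (hN : ∀ i, (N i).Normal) (Q : Finset X) :
    (interOf N Q).Normal :=
  normal_iInf_normal fun i => hN i

theorem commutator_le_interOf_insert {X : Type*} [DecidableEq X] {N : X → Subgroup G}
    (hN : ∀ i, (N i).Normal) (Q : Finset X) (j : X) :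
    ⁅N j, interOf N Q⁆ ≤ interOf N (insert j Q) := by
  have := hN j
  have := interOf_normal hN Q
  refine le_interOf_iff.2 fun i hi => ?_
  rcases Finset.mem_insert.1 hi with rfl | hi
  · exact commutator_le_left _ _
  · exact (commutator_le_right _ _).trans (interOf_le hi)

end

/-! ### Multiplicativity up to errors, and late derived subgroups as entries -/

namespace CommutatorTree

variable {X G : Type*} [Group G]

theorem derivedSubgroup_le_subgroup {N : X → Subgroup G} {A : Subgroup G} [A.Normal] :
    ∀ {t : CommutatorTree X}, (∀ i ∈ t.leaves, A ≤ N i) → ∀ {c : ℕ}, t.height ≤ c →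
      derivedSubgroup A c ≤ t.subgroup N
  | leaf x, h, c, _ => (derivedSubgroup_antitone A c.zero_le).trans (h x rfl)
  | node a b, h, c, hc => by
    simp only [height] at hc
    obtain ⟨d, rfl⟩ : ∃ d, c = d + 1 := ⟨c - 1, by omega⟩
    exact commutator_mono
      (derivedSubgroup_le_subgroup (fun i hi => h i (.inl hi)) (by omega))
      (derivedSubgroup_le_subgroup (fun i hi => h i (.inr hi)) (by omega))

variable [DecidableEq X]

/-- Iterated commutators are multiplicative in the entry `l` modulo the iterated commutators in
which another entry is replaced by its commutator with the entry `l`. -/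
theorem mk_eval_update_mul {K : X → Subgroup G} (hK : ∀ i, (K i).Normal) {l : X} {g : X → G}
    (hg : ∀ i, g i ∈ K i) {x y : G} (hx : x ∈ K l) (hy : y ∈ K l) :
    ∀ {t : CommutatorTree X}, t.IsLinear → l ∈ t.leaves → ∀ (M : Subgroup G) [M.Normal],
      (∀ i ∈ t.leaves, i ≠ l → t.subgroup (update K i ⁅K i, K l⁆) ≤ M) →
        ((t.eval (update g l (x * y)) : G) : G ⧸ M) =
          (t.eval (update g l x) : G) * (t.eval (update g l y) : G)
  | leaf i, _, hl, M, _, _ => by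
    obtain rfl := Set.mem_singleton_iff.1 hl
    simp [eval]
  | node a b, ht, hl, M, _, h => by
    have hup {z : G} (hz : z ∈ K l) (i : X) : update g l z i ∈ K i := by
      rcases eq_or_ne i l with rfl | hi
      · simpa using hz
      · simpa [hi] using hg i
    have := hK l
    have := a.subgroup_normal hK
    have := b.subgroup_normal hK
    simp only [eval]
    rcases hl with hl | hl
    · have hl' := Set.disjoint_left.1 ht.2.2 hl
      -- Since `l` is a leaf of `a`, the inner commutator lies in that of `K l` with the branch `b`.
      -- This distributes over the leaves of `b`, and each resulting term, commuted with `a`, is one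
      -- of the allowed errors.
      have herr : ⁅a.subgroup K, ⁅a.subgroup K, b.subgroup K⁆⁆ ≤ M := by
        have hb : ⁅K l, b.subgroup K⁆ ≤ residual M (a.subgroup K) :=
          commutator_subgroup_le hK (K l) ht.2.1 _ fun i hi => by
            rw [le_residual_iff, commutator_comm]
            have hia := Set.disjoint_right.1 ht.2.2 hi
            have := h i (.inr hi) (ne_of_mem_of_not_mem hl hia).symm
            rwa [subgroup, subgroup_update_of_notMem (t := a) hia] at this
        rw [commutator_comm, ← le_residual_iff]
        exact (commutator_mono (subgroup_le hK hl) le_rfl).trans hb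
      have ih := mk_eval_update_mul hK hg hx hy ht.1 hl (residual M (b.subgroup K))
        fun i hi hne => by
          rw [le_residual_iff]
          have := h i (.inl hi) hne
          rwa [subgroup, subgroup_update_of_notMem (t := b) (Set.disjoint_left.1 ht.2.2 hi)] at this
      simp only [eval_update_of_notMem hl']
      exact (mk_commutatorElement_mul herr (a.eval_mem_subgroup (hup hx))
        (a.eval_mem_subgroup (hup hy)) (b.eval_mem_subgroup hg) ih).1
    · have hl' := Set.disjoint_right.1 ht.2.2 hl
      have herr : ⁅b.subgroup K, ⁅b.subgroup K, a.subgroup K⁆⁆ ≤ M := by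
        have ha : ⁅K l, a.subgroup K⁆ ≤ residual M (b.subgroup K) :=
          commutator_subgroup_le hK (K l) ht.1 _ fun i hi => by
            rw [le_residual_iff]
            have hib := Set.disjoint_left.1 ht.2.2 hi
            have := h i (.inl hi) (ne_of_mem_of_not_mem hl hib).symm
            rwa [subgroup, subgroup_update_of_notMem (t := b) hib] at this
        rw [commutator_comm, ← le_residual_iff]
        exact (commutator_mono (subgroup_le hK hl) le_rfl).trans ha
      have ih := mk_eval_update_mul hK hg hx hy ht.2.1 hl (residual M (a.subgroup K))
        fun i hi hne => by
          rw [le_residual_iff, commutator_comm]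
          have := h i (.inr hi) hne
          rwa [subgroup, subgroup_update_of_notMem (t := a) (Set.disjoint_right.1 ht.2.2 hi)] at this
      simp only [eval_update_of_notMem hl']
      obtain ⟨h₁, h₂⟩ := mk_commutatorElement_mul herr (b.eval_mem_subgroup (hup hx))
        (b.eval_mem_subgroup (hup hy)) (a.eval_mem_subgroup hg) ih
      -- With `l` on the right, ⁅a, b⁆ is the inverse of ⁅b, a⁆; since the factors commute,
      -- inverting keeps their order.
      rw [h₂.eq] at h₁
      have := congrArg (·⁻¹) h₁
      simpa only [mul_inv_rev, ← QuotientGroup.mk_inv, commutatorElement_inv] using this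

theorem mk_eval_update_pow {K : X → Subgroup G} (hK : ∀ i, (K i).Normal) {l : X} {g : X → G}
    (hg : ∀ i, g i ∈ K i) {t : CommutatorTree X} (ht : t.IsLinear) (hl : l ∈ t.leaves)
    (M : Subgroup G) [M.Normal]
    (h : ∀ i ∈ t.leaves, i ≠ l → t.subgroup (update K i ⁅K i, K l⁆) ≤ M) (n : ℕ) :
    ((t.eval (update g l (g l ^ n)) : G) : G ⧸ M) = (t.eval g : G) ^ n := by
  have key {x y : G} (hx : x ∈ K l) (hy : y ∈ K l) := mk_eval_update_mul hK hg hx hy ht hl M h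
  induction n with
  | zero =>
    have := key (K l).one_mem (K l).one_mem
    rw [mul_one] at this
    simpa using this
  | succ n ih => rw [pow_succ, key ((K l).pow_mem (hg l) n) (hg l), ih, update_eq_self, pow_succ]

/-- Commutation with a late term of the derived series of an intersection of entries distributes
over the leaves that do not take part in that intersection. -/
theorem commutator_derivedSubgroup_le {N : X → Subgroup G} (hN : ∀ i, (N i).Normal)
    (Q : Finset X) : ∀ {t : CommutatorTree X}, t.IsLinear → ¬ t.leaves ⊆ Q →
      ∀ {c : ℕ}, t.height ≤ c → ∀ (M : Subgroup G) [M.Normal],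
        (∀ i ∈ t.leaves, i ∉ Q → t.subgroup (update N i ⁅N i, interOf N Q⁆) ≤ M) →
          ⁅derivedSubgroup (interOf N Q) c, t.subgroup N⁆ ≤ M
  | leaf x, _, hQ, c, _, M, _, h => by
    have := interOf_normal hN Q
    have h' := h x rfl (by simpa [leaves] using hQ)
    simp only [subgroup, update_self] at h'
    rw [commutator_comm]
    exact (commutator_mono le_rfl (derivedSubgroup_antitone _ c.zero_le)).trans h'
  | node a b, ht, hQ, c, hc, M, _, h => by
    have := interOf_normal hN Q
    have := a.subgroup_normal hN
    have := b.subgroup_normal hN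
    simp only [height] at hc
    obtain ⟨d, rfl⟩ : ∃ d, c = d + 1 := ⟨c - 1, by omega⟩
    have ha {e : ℕ} (he : a.height ≤ e) (hQa : ¬ a.leaves ⊆ Q) :
        ⁅derivedSubgroup (interOf N Q) e, a.subgroup N⁆ ≤ residual M (b.subgroup N) :=
      commutator_derivedSubgroup_le hN Q ht.1 hQa he _ fun i hi hiQ => by
        rw [le_residual_iff]
        have := h i (.inl hi) hiQ
        rwa [subgroup, subgroup_update_of_notMem (t := b) (Set.disjoint_left.1 ht.2.2 hi)] at this
    have hb {e : ℕ} (he : b.height ≤ e) (hQb : ¬ b.leaves ⊆ Q) :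
        ⁅derivedSubgroup (interOf N Q) e, b.subgroup N⁆ ≤ residual M (a.subgroup N) :=
      commutator_derivedSubgroup_le hN Q ht.2.1 hQb he _ fun i hi hiQ => by
        rw [le_residual_iff, commutator_comm]
        have := h i (.inr hi) hiQ
        rwa [subgroup, subgroup_update_of_notMem (t := a) (Set.disjoint_right.1 ht.2.2 hi)] at this
    refine commutator_commutator_right_le ?_ ?_
    · by_cases hQa : a.leaves ⊆ Q
      · have hQb : ¬ b.leaves ⊆ Q := fun hQb => hQ (Set.union_subset hQa hQb)
        have hA : derivedSubgroup (interOf N Q) d ≤ a.subgroup N :=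
          derivedSubgroup_le_subgroup (fun i hi => interOf_le (hQa hi)) (by omega)
        -- With D_i the derived series of the intersection, ⁅D_(d+1), B⁆ ≤ ⁅D_d, ⁅D_d, B⁆⁆. The
        -- outer D_d lies in the branch `a`, whose leaves are all in `Q`; the inner one is
        -- distributed over `b` by recursion.
        refine (commutator_mono (commutator_le_left _ _) le_rfl).trans
          ((commutator_derivedSubgroup_succ_le _ _ _).trans ?_)
        rw [commutator_comm, ← le_residual_iff]
        exact (hb (by omega) hQb).trans (le_residual_iff.2
          ((commutator_mono le_rfl hA).trans (le_residual_iff.1 le_rfl)))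
      · exact le_residual_iff.1 (ha (by omega) hQa)
    · by_cases hQb : b.leaves ⊆ Q
      · have hQa : ¬ a.leaves ⊆ Q := fun hQa => hQ (Set.union_subset hQa hQb)
        have hB : derivedSubgroup (interOf N Q) d ≤ b.subgroup N :=
          derivedSubgroup_le_subgroup (fun i hi => interOf_le (hQb hi)) (by omega)
        refine (commutator_mono (commutator_le_left _ _) le_rfl).trans
          ((commutator_derivedSubgroup_succ_le _ _ _).trans ?_)
        rw [commutator_comm, ← le_residual_iff]
        exact (ha (by omega) hQa).trans (le_residual_iff.2
          ((commutator_mono le_rfl hB).trans (le_residual_iff.1 le_rfl)))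
      · exact le_residual_iff.1 (hb (by omega) hQb)

/-- If an entry in `Q` is replaced by a late term of the derived series of the intersection of the
entries in `Q`, then the iterated commutator is covered by those in which some entry outside `Q` is
replaced by its commutator with this intersection. -/
theorem subgroup_update_derivedSubgroup_le {N : X → Subgroup G} (hN : ∀ i, (N i).Normal)
    (Q : Finset X) {l : X} (hlQ : l ∈ Q) : ∀ {t : CommutatorTree X}, t.IsLinear → l ∈ t.leaves →
      ¬ t.leaves ⊆ Q → ∀ {c : ℕ}, t.height ≤ c → ∀ (M : Subgroup G) [M.Normal],
        (∀ i ∈ t.leaves, i ∉ Q → t.subgroup (update N i ⁅N i, interOf N Q⁆) ≤ M) →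
          t.subgroup (update N l (derivedSubgroup (interOf N Q) c)) ≤ M
  | leaf x, _, hl, hQ, c, _, M, _, _ => by
    obtain rfl := Set.mem_singleton_iff.1 hl
    exact absurd (by simpa [leaves] using hlQ) hQ
  | node a b, ht, hl, hQ, c, hc, M, _, h => by
    have := interOf_normal hN Q
    have := a.subgroup_normal hN
    have := b.subgroup_normal hN
    simp only [height] at hc
    obtain ⟨d, rfl⟩ : ∃ d, c = d + 1 := ⟨c - 1, by omega⟩
    have ha : ∀ i ∈ a.leaves, i ∉ Q →
        a.subgroup (update N i ⁅N i, interOf N Q⁆) ≤ residual M (b.subgroup N) :=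
      fun i hi hiQ => by
        rw [le_residual_iff]
        have := h i (.inl hi) hiQ
        rwa [subgroup, subgroup_update_of_notMem (t := b) (Set.disjoint_left.1 ht.2.2 hi)] at this
    have hb : ∀ i ∈ b.leaves, i ∉ Q →
        b.subgroup (update N i ⁅N i, interOf N Q⁆) ≤ residual M (a.subgroup N) :=
      fun i hi hiQ => by
        rw [le_residual_iff, commutator_comm]
        have := h i (.inr hi) hiQ
        rwa [subgroup, subgroup_update_of_notMem (t := a) (Set.disjoint_right.1 ht.2.2 hi)] at this
    have hle {s : CommutatorTree X} (hs : l ∈ s.leaves) :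
        s.subgroup (update N l (derivedSubgroup (interOf N Q) (d + 1))) ≤
          derivedSubgroup (interOf N Q) (d + 1) := by
      simpa using subgroup_le (update_normal hN l (derivedSubgroup (interOf N Q) (d + 1))) hs
    rcases hl with hl | hl
    · rw [subgroup, subgroup_update_of_notMem (t := b) (Set.disjoint_left.1 ht.2.2 hl)]
      by_cases hQa : a.leaves ⊆ Q
      · have hQb : ¬ b.leaves ⊆ Q := fun hQb => hQ (Set.union_subset hQa hQb)
        -- The modified branch lies in D_(d+1). One derived step is spent: of the two copies of D_d,
        -- one recovers the unmodified branch `a` and the other is distributed over `b`.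
        refine (commutator_mono (hle hl) le_rfl).trans
          ((commutator_derivedSubgroup_succ_le _ _ _).trans ?_)
        rw [commutator_comm]
        refine (commutator_mono
          (commutator_derivedSubgroup_le hN Q ht.2.1 hQb (c := d) (by omega) _ hb)
          (derivedSubgroup_le_subgroup (fun i hi => interOf_le (hQa hi)) (by omega))).trans ?_
        exact le_residual_iff.1 le_rfl
      · rw [← le_residual_iff]
        exact subgroup_update_derivedSubgroup_le hN Q hlQ ht.1 hl hQa (by omega) _ ha
    · rw [subgroup, subgroup_update_of_notMem (t := a) (Set.disjoint_right.1 ht.2.2 hl),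
        commutator_comm]
      by_cases hQb : b.leaves ⊆ Q
      · have hQa : ¬ a.leaves ⊆ Q := fun hQa => hQ (Set.union_subset hQa hQb)
        refine (commutator_mono (hle hl) le_rfl).trans
          ((commutator_derivedSubgroup_succ_le _ _ _).trans ?_)
        rw [commutator_comm]
        refine (commutator_mono
          (commutator_derivedSubgroup_le hN Q ht.1 hQa (c := d) (by omega) _ ha)
          (derivedSubgroup_le_subgroup (fun i hi => interOf_le (hQb hi)) (by omega))).trans ?_
        exact le_residual_iff.1 le_rfl
      · rw [← le_residual_iff]
        exact subgroup_update_derivedSubgroup_le hN Q hlQ ht.2.1 hl hQb (by omega) _ hb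

end CommutatorTree

/-! ### Normal subsets and their iterated quotients -/

section

variable {G : Type*} [Group G]

/-- The set of all commutatorsOf of an element of `A` with an element of `B`. -/
def commutatorsOf (A B : Set G) : Set G :=
  Set.image2 (fun x y => ⁅x, y⁆) A B

/-- The set of all quotientsOf of two elements of `V`. -/
def quotientsOf (V : Set G) : Set G :=
  Set.image2 (fun x y => x * y⁻¹) V V

theorem IsNormalSubset.commutators {A B : Set G} (hA : IsNormalSubset A) (hB : IsNormalSubset B) :
    IsNormalSubset (commutatorsOf A B) := by
  rintro _ ⟨x, hx, y, hy, rfl⟩ g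
  exact ⟨_, hA x hx g, _, hB y hy g, (conjugate_commutatorElement _ _ _).symm⟩

theorem IsNormalSubset.quotients {V : Set G} (hV : IsNormalSubset V) :
    IsNormalSubset (quotientsOf V) := by
  rintro _ ⟨x, hx, y, hy, rfl⟩ g
  exact ⟨_, hV x hx g, _, hV y hy g, by group⟩

theorem IsNormalSubset.iterate_quotients {V : Set G} (hV : IsNormalSubset V) :
    ∀ k, IsNormalSubset (quotientsOf^[k] V)
  | 0 => hV
  | k + 1 => by
    rw [iterate_succ_apply']
    exact (hV.iterate_quotients k).quotients

theorem Subgroup.Normal.isNormalSubset {H : Subgroup G} (hH : H.Normal) :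
    IsNormalSubset (H : Set G) :=
  hH.conj_mem

theorem IsNormalSubset.normal_closure {V : Set G} (hV : IsNormalSubset V) :
    (closure V).Normal where
  conj_mem x hx g := by
    have : closure V ≤ (closure V).comap (MulAut.conj g).toMonoidHom :=
      (closure_le _).2 fun v hv => subset_closure (hV v hv g)
    exact this hx

theorem quotients_mono {U V : Set G} (h : U ⊆ V) : quotientsOf U ⊆ quotientsOf V :=
  Set.image2_subset h h

theorem subset_quotients {V : Set G} (h : 1 ∈ V) : V ⊆ quotientsOf V :=
  fun x hx => ⟨x, hx, 1, h, by simp⟩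

theorem one_mem_iterate_quotients {V : Set G} (h : 1 ∈ V) : ∀ k, 1 ∈ quotientsOf^[k] V
  | 0 => h
  | k + 1 => by
    rw [iterate_succ_apply']
    exact subset_quotients (one_mem_iterate_quotients h k) (one_mem_iterate_quotients h k)

theorem iterate_quotients_subset_succ {V : Set G} (h : 1 ∈ V) (k : ℕ) :
    quotientsOf^[k] V ⊆ quotientsOf^[k + 1] V := by
  rw [iterate_succ_apply']
  exact subset_quotients (one_mem_iterate_quotients h k)

theorem subset_iterate_quotients {V : Set G} (h : 1 ∈ V) (k : ℕ) : V ⊆ quotientsOf^[k] V := by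
  induction k with
  | zero => exact subset_rfl
  | succ k ih => exact ih.trans (iterate_quotients_subset_succ h k)

theorem iterate_quotients_subset_subgroup {V : Set G} {H : Subgroup G} (h : V ⊆ H) :
    ∀ k, quotientsOf^[k] V ⊆ H
  | 0 => h
  | k + 1 => by
    rw [iterate_succ_apply']
    rintro _ ⟨x, hx, y, hy, rfl⟩
    exact H.mul_mem (iterate_quotients_subset_subgroup h k hx)
      (H.inv_mem (iterate_quotients_subset_subgroup h k hy))

theorem finite_iterate_quotients {V : Set G} (hV : V.Finite) :
    ∀ k, (quotientsOf^[k] V).Finite ∧ (quotientsOf^[k] V).ncard ≤ V.ncard ^ 2 ^ k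
  | 0 => ⟨hV, by simp⟩
  | k + 1 => by
    obtain ⟨h₁, h₂⟩ := finite_iterate_quotients hV k
    rw [iterate_succ_apply']
    refine ⟨h₁.image2 _ h₁, ?_⟩
    rw [quotientsOf, ← Set.image_prod, pow_succ 2, pow_mul, sq (V.ncard ^ 2 ^ k)]
    refine (Set.ncard_image_le (h₁.prod h₁)).trans ?_
    rw [Set.ncard_prod]
    exact Nat.mul_le_mul h₂ h₂

theorem commutators_subset_quotients {A B : Set G} (hA : IsNormalSubset A) :
    commutatorsOf A B ⊆ quotientsOf A := by
  rintro _ ⟨x, hx, y, -, rfl⟩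
  exact ⟨x, hx, _, hA x hx y, by simp [commutatorElement_def, mul_assoc]⟩

/-- Expanding ⁅xy⁻¹, b⁆ gives a conjugate of ⁅y, b⁆⁻¹ times ⁅x, b⁆; the first factor moves to the
right at the cost of another conjugation, harmless in a normal set. -/
theorem commutators_quotients_left {A B : Set G} (hA : IsNormalSubset A) (hB : IsNormalSubset B) :
    commutatorsOf (quotientsOf A) B ⊆ quotientsOf (commutatorsOf A B) := by
  rintro _ ⟨_, ⟨x, hx, y, hy, rfl⟩, b, hb, rfl⟩
  have hN := hA.commutators hB
  have hQ : ⁅x, b⁆ ∈ commutatorsOf A B := ⟨x, hx, b, hb, rfl⟩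
  have hP : ⁅y, b⁆ ∈ commutatorsOf A B := ⟨y, hy, b, hb, rfl⟩
  refine ⟨_, hQ, _, hN _ (hN _ hP (x * y⁻¹)) ⁅x, b⁆⁻¹, ?_⟩
  simp only [commutatorElement_def]
  group

theorem commutators_quotients_right {A B : Set G} (hA : IsNormalSubset A)
    (hB : IsNormalSubset B) :
    commutatorsOf A (quotientsOf B) ⊆ quotientsOf (commutatorsOf A B) := by
  rintro _ ⟨a, ha, b, hb, rfl⟩
  obtain ⟨_, ⟨x, hx, y, hy, rfl⟩, _, ⟨z, hz, w, hw, rfl⟩, h⟩ :=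
    commutators_quotients_left hB hA ⟨b, hb, a, ha, rfl⟩
  have hN := hA.commutators hB
  refine ⟨_, ⟨y, hy, x, hx, rfl⟩, _, hN _ ⟨w, hw, z, hz, rfl⟩ ⁅y, x⁆⁻¹, ?_⟩
  have := congrArg (·⁻¹) h
  simp only [mul_inv_rev, commutatorElement_inv] at this
  dsimp only
  rw [← this, ← commutatorElement_inv w z]
  group

theorem commutators_iterate_quotients {A B : Set G} (hA : IsNormalSubset A)
    (hB : IsNormalSubset B) (i j : ℕ) :
    commutatorsOf (quotientsOf^[i] A) (quotientsOf^[j] B) ⊆ quotientsOf^[i + j] (commutatorsOf A B) := by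
  induction i with
  | zero =>
    induction j with
    | zero => exact subset_rfl
    | succ j ih =>
      rw [iterate_succ_apply', ← add_assoc, iterate_succ_apply']
      exact (commutators_quotients_right hA (hB.iterate_quotients j)).trans (quotients_mono ih)
  | succ i ih =>
    rw [iterate_succ_apply', Nat.succ_add, iterate_succ_apply']
    exact (commutators_quotients_left (hA.iterate_quotients i) (hB.iterate_quotients j)).trans
      (quotients_mono ih)

theorem commutator_mem_of_mem_closure {M : Subgroup G} [M.Normal] {A : Set G} {b : G}
    (h : ∀ a ∈ A, ⁅a, b⁆ ∈ M) {a : G} (ha : a ∈ closure A) : ⁅a, b⁆ ∈ M := by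
  induction ha using closure_induction with
  | mem x hx => exact h x hx
  | one => simp
  | mul x y _ _ hx hy =>
    rw [commutatorElement_mul_left_eq_conj_mul]
    exact M.mul_mem (Normal.conj_mem ‹_› _ hy x) hx
  | inv x _ hx =>
    rw [commutatorElement_inv_left, ← commutatorElement_inv]
    simpa using Normal.conj_mem ‹_› _ (M.inv_mem hx) x⁻¹

theorem commutator_closure_closure {A B : Set G} (hA : IsNormalSubset A) (hB : IsNormalSubset B) :
    ⁅closure A, closure B⁆ = closure (commutatorsOf A B) := by
  have := (hA.commutators hB).normal_closure
  refine le_antisymm (commutator_le.2 fun a ha b hb => ?_) ((closure_le _).2 ?_)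
  · refine commutator_mem_of_mem_closure (fun x hx => ?_) ha
    rw [← commutatorElement_inv]
    refine inv_mem (commutator_mem_of_mem_closure (fun y hy => ?_) hb)
    rw [← commutatorElement_inv]
    exact inv_mem (subset_closure ⟨x, hx, y, hy, rfl⟩)
  · rintro _ ⟨x, hx, y, hy, rfl⟩
    exact commutator_mem_commutator (subset_closure hx) (subset_closure hy)

/-- The elements of a commutative subgroup whose order divides `e`. -/
def powKernel (W : Subgroup G) (hW : ∀ x ∈ W, ∀ y ∈ W, x * y = y * x) (e : ℕ) : Subgroup G where
  carrier := {x | x ∈ W ∧ x ^ e = 1}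
  one_mem' := ⟨W.one_mem, one_pow e⟩
  mul_mem' := fun {x y} hx hy =>
    ⟨W.mul_mem hx.1 hy.1, by
      rw [Commute.mul_pow (hW x hx.1 y hy.1), hx.2, hy.2, one_mul]⟩
  inv_mem' := fun {x} hx => ⟨W.inv_mem hx.1, by rw [inv_pow, hx.2, inv_one]⟩

theorem powKernel_normal {W : Subgroup G} [hn : W.Normal] (hW : ∀ x ∈ W, ∀ y ∈ W, x * y = y * x)
    (e : ℕ) : (powKernel W hW e).Normal where
  conj_mem x hx g := ⟨hn.conj_mem x hx.1 g, by rw [conj_pow, hx.2, mul_one, mul_inv_cancel]⟩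

end

namespace CommutatorTree

variable {X G : Type*} [Group G]

theorem isNormalSubset_values {T : X → Set G} (hT : ∀ i, IsNormalSubset (T i)) :
    ∀ t : CommutatorTree X, IsNormalSubset (t.values T)
  | leaf x => hT x
  | node a b => (a.isNormalSubset_values hT).commutators (b.isNormalSubset_values hT)

theorem subgroup_closure {T : X → Set G} (hT : ∀ i, IsNormalSubset (T i)) :
    ∀ t : CommutatorTree X, t.subgroup (fun i => closure (T i)) = closure (t.values T)
  | leaf _ => rfl
  | node a b => by
    rw [subgroup, a.subgroup_closure hT, b.subgroup_closure hT,
      commutator_closure_closure (a.isNormalSubset_values hT) (b.isNormalSubset_values hT)]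
    rfl

/-- Depths add under commutators, so each leaf contributes `k`. This bounds the number of values at
depth `k`, as the pigeonhole argument requires. -/
theorem values_iterate_quotients {T : X → Set G} (hT : ∀ i, IsNormalSubset (T i)) (k : ℕ) :
    ∀ t : CommutatorTree X,
      t.values (fun i => quotientsOf^[k] (T i)) ⊆ quotientsOf^[t.size * k] (t.values T)
  | leaf _ => by simp [values, size]
  | node a b => by
    rw [size, add_mul]
    exact (Set.image2_subset (a.values_iterate_quotients hT k)
      (b.values_iterate_quotients hT k)).trans (commutators_iterate_quotients
        (a.isNormalSubset_values hT) (b.isNormalSubset_values hT) _ _)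

end CommutatorTree

/-! ### Bounding the exponent in the abelian case -/

namespace CommutatorTree

variable {X : Type*}

/-- Normal subgroups `N i` with normal generating sets `S i` that contain all `n i`-th powers, such
that the tree `t` has at most `m` values on `S` and its values on `N` generate an abelian group. -/
structure AbelianSetting {G : Type u} [Group G] (t : CommutatorTree X) (m : ℕ) (n : X → ℕ)
    (N : X → Subgroup G) (S : X → Set G) : Prop where
  linear : t.IsLinear
  leaves_eq : t.leaves = Set.univ
  normal : ∀ i, (N i).Normal
  closure_eq : ∀ i, N i = closure (S i)
  isNormalSubset : ∀ i, IsNormalSubset (S i)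
  pos : ∀ i, 0 < n i
  pow_mem : ∀ i, ∀ x ∈ N i, x ^ n i ∈ S i
  finite : (t.values S).Finite
  ncard_le : (t.values S).ncard ≤ m
  comm : ∀ x ∈ t.subgroup N, ∀ y ∈ t.subgroup N, x * y = y * x

/-- A tuple of normal subsets whose elements are quotients of depth `k` of elements of `S`. -/
structure IsAdmissible {G : Type u} [Group G] (S : X → Set G) (k : ℕ) (T : X → Set G) : Prop where
  isNormalSubset : ∀ i, IsNormalSubset (T i)
  one_mem : ∀ i, 1 ∈ T i
  subset : ∀ i, T i ⊆ quotientsOf^[k] (S i)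

section

variable {G : Type u} [Group G] {t : CommutatorTree X} {m : ℕ} {n : X → ℕ}
  {N : X → Subgroup G} {S T : X → Set G} {k : ℕ}

namespace AbelianSetting

theorem one_mem (h : AbelianSetting t m n N S) (i : X) : 1 ∈ S i := by
  simpa using h.pow_mem i 1 (N i).one_mem

theorem subset (h : AbelianSetting t m n N S) (i : X) : S i ⊆ N i := by
  rw [h.closure_eq i]
  exact subset_closure

theorem isAdmissible (h : AbelianSetting t m n N S) (k : ℕ) : IsAdmissible S k S where
  isNormalSubset := h.isNormalSubset
  one_mem := h.one_mem
  subset i := subset_iterate_quotients (h.one_mem i) k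

theorem closure_le (h : AbelianSetting t m n N S) (hT : IsAdmissible S k T) (i : X) :
    closure (T i) ≤ N i :=
  (Subgroup.closure_le _).2
    ((hT.subset i).trans (iterate_quotients_subset_subgroup (h.subset i) k))

theorem subgroup_closure_le (h : AbelianSetting t m n N S) (hT : IsAdmissible S k T) :
    t.subgroup (fun i => closure (T i)) ≤ t.subgroup N :=
  subgroup_mono (h.closure_le hT) t

theorem size_eq [Fintype X] (h : AbelianSetting t m n N S) : t.size = Fintype.card X := by
  rw [(t.size_eq_ncard h.linear).2, h.leaves_eq, Set.ncard_univ, Nat.card_eq_fintype_card]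

theorem finite_values [Fintype X] (h : AbelianSetting t m n N S) (k : ℕ) :
    (t.values fun i => quotientsOf^[k] (S i)).Finite ∧
      (t.values fun i => quotientsOf^[k] (S i)).ncard ≤ m ^ 2 ^ (Fintype.card X * k) := by
  obtain ⟨h₁, h₂⟩ := finite_iterate_quotients h.finite (t.size * k)
  have hs := values_iterate_quotients h.isNormalSubset k t
  refine ⟨h₁.subset hs, (Set.ncard_le_ncard hs h₁).trans (h₂.trans ?_)⟩
  rw [h.size_eq]
  exact Nat.pow_le_pow_left h.ncard_le _

end AbelianSetting

theorem IsAdmissible.update [DecidableEq X] (h : AbelianSetting t m n N S)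
    (hT : IsAdmissible S k T) (i : X) {E : Subgroup G} (hE : E.Normal) :
    IsAdmissible S (k + 1) (update T i (commutatorsOf (T i) E)) where
  isNormalSubset j := by
    rcases eq_or_ne j i with rfl | hj
    · simpa using (hT.isNormalSubset j).commutators hE.isNormalSubset
    · simpa [hj] using hT.isNormalSubset j
  one_mem j := by
    rcases eq_or_ne j i with rfl | hj
    · simpa using! (⟨1, hT.one_mem j, 1, E.one_mem, by simp⟩ : 1 ∈ commutatorsOf (T j) E)
    · simpa [hj] using hT.one_mem j
  subset j := by
    rcases eq_or_ne j i with rfl | hj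
    · rw [update_self, iterate_succ_apply']
      exact (commutators_subset_quotients (hT.isNormalSubset j)).trans
        (quotients_mono (hT.subset j))
    · rw [update_of_ne hj]
      exact (hT.subset j).trans (iterate_quotients_subset_succ (h.one_mem j) k)

theorem IsAdmissible.subgroup_update [DecidableEq X] (hT : IsAdmissible S k T) (i : X)
    {E : Subgroup G} (hE : E.Normal) (s : CommutatorTree X) :
    s.subgroup (Function.update (fun j => closure (T j)) i ⁅closure (T i), E⁆) =
      s.subgroup fun j => closure (Function.update T i (commutatorsOf (T i) E) j) := by
  congr 1
  funext j
  rcases eq_or_ne j i with rfl | hj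
  · simp only [update_self]
    rw [← commutator_closure_closure (hT.isNormalSubset j) hE.isNormalSubset, closure_eq]
  · simp [hj]

end

/-- The number `e` annihilates the iterated commutators on every tuple of depth `k` in which the
entries with index in a `p`-subset of some `q`-set `Q` lie in the `c`-th derived subgroup of the
intersection of the entries in `Q`. -/
def Annihilates [Fintype X] (m : ℕ) (n : X → ℕ) (q c p k e : ℕ) : Prop :=
  ∀ (G : Type u) [Group G] (t : CommutatorTree X) (N : X → Subgroup G) (S T : X → Set G)
    (Q P : Finset X), AbelianSetting t m n N S → IsAdmissible S k T → Q.card = q → P ⊆ Q →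
      P.card = p → (∀ l ∈ P, T l ⊆ derivedSubgroup (interOf N Q) c) →
        ∀ x ∈ t.subgroup fun i => closure (T i), x ^ e = 1

variable [Fintype X] {m : ℕ} {n : X → ℕ}

/-- Base of the induction on `c`: an entry this deep in the derived series can be traded for an
entry ⁅N i, I⁆ with `i` outside `Q`, where I is the intersection over `Q`. -/
theorem annihilates_of_card_le {q c k e : ℕ} (hc : Fintype.card X ≤ c)
    (h : Annihilates.{u} m n (q + 1) 0 1 1 e) : Annihilates.{u} m n q c 1 k e := by
  classical
  intro G _ t N S T Q P hS hT hQ hPQ hP hPT x hx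
  obtain ⟨l, rfl⟩ := Finset.card_eq_one.1 hP
  have hlQ : l ∈ Q := hPQ (Finset.mem_singleton_self l)
  have hTl := hPT l (Finset.mem_singleton_self l)
  have hl : l ∈ t.leaves := hS.leaves_eq ▸ Set.mem_univ l
  have hht : t.height < c := (t.height_lt_size.trans_eq hS.size_eq).trans_le hc
  have hQn := interOf_normal hS.normal Q
  by_cases htQ : t.leaves ⊆ Q
  -- If `Q` contains every variable, the derived subgroup one step earlier already lies in the
  -- abelian subgroup `t.subgroup N`, so the `c`-th one is trivial.
  · obtain ⟨d, rfl⟩ : ∃ d, c = d + 1 := ⟨c - 1, by omega⟩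
    have hd : derivedSubgroup (interOf N Q) d ≤ t.subgroup N :=
      derivedSubgroup_le_subgroup (fun i hi => interOf_le (htQ hi)) (by omega)
    have hbot : derivedSubgroup (interOf N Q) (d + 1) ≤ ⊥ :=
      commutator_le.2 fun a ha b hb => by
        rw [mem_bot, commutatorElement_eq_one_iff_mul_comm]
        exact hS.comm a (hd ha) b (hd hb)
    have := subgroup_le (fun i => (hT.isNormalSubset i).normal_closure) hl hx
    have hx1 : x = 1 := mem_bot.1 (hbot ((Subgroup.closure_le _).2 hTl this))
    rw [hx1, one_pow]
  · have hW := t.subgroup_normal hS.normal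
    have := powKernel_normal hS.comm e
    have key := subgroup_update_derivedSubgroup_le hS.normal Q hlQ hS.linear hl htQ hht.le
      (powKernel (t.subgroup N) hS.comm e) fun i _ hiQ => ?_
    · refine (key (subgroup_mono (fun j => ?_) t hx)).2
      rcases eq_or_ne j l with rfl | hj
      · simpa using hTl
      · simpa [hj] using hS.closure_le hT j
    -- The covering terms involve the full `N i`, generated by `S i`. The tuple `T` is thus
    -- forgotten and the depth restarts at 0, becoming 1 after one commutator.
    · have hA := IsAdmissible.update hS (hS.isAdmissible 0) i hQn
      have heq := (hS.isAdmissible 0).subgroup_update i hQn t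
      simp only [← hS.closure_eq] at heq
      rw [heq]
      refine fun y hy => ⟨hS.subgroup_closure_le hA hy, ?_⟩
      refine h G t N S _ (insert i Q) {i} hS hA (by rw [Finset.card_insert_of_notMem hiQ, hQ])
        (by simp) (by simp) (fun j hj => ?_) y hy
      obtain rfl := Finset.mem_singleton.1 hj
      rw [update_self]
      rintro _ ⟨s, hs, z, hz, rfl⟩
      exact commutator_le_interOf_insert hS.normal Q j
        (commutator_mem_commutator (hS.subset j hs) hz)

/-- The exponents `e₁`, `e₂`, `e₃` kill the errors at i ∈ P, i ∈ Q ∖ P and i ∉ Q respectively;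
pigeonhole modulo these errors supplies the remaining factor. -/
theorem annihilates_step {q c p k e₁ e₂ e₃ : ℕ} (hp : 1 ≤ p)
    (h₁ : Annihilates.{u} m n q (c + 1) 1 (k + 1) e₁)
    (h₂ : Annihilates.{u} m n q c (p + 1) (k + 1) e₂)
    (h₃ : Annihilates.{u} m n (q + 1) 0 1 (k + 1) e₃) :
    Annihilates.{u} m n q c p k
      ((∏ i, n i) * (m ^ 2 ^ (Fintype.card X * k)).factorial * (e₁ * e₂ * e₃)) := by
  classical
  intro G _ t N S T Q P hS hT hQ hPQ hP hPT
  set e := e₁ * e₂ * e₃ with he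
  set μ := m ^ 2 ^ (Fintype.card X * k) with hμ
  obtain ⟨l, hlP⟩ : P.Nonempty := Finset.card_pos.1 (by omega)
  have hl : l ∈ t.leaves := hS.leaves_eq ▸ Set.mem_univ l
  have hQn := interOf_normal hS.normal Q
  have hKn (i : X) : (closure (T i)).Normal := (hT.isNormalSubset i).normal_closure
  have hKl : closure (T l) ≤ derivedSubgroup (interOf N Q) c :=
    (Subgroup.closure_le _).2 (hPT l hlP)
  have hW := t.subgroup_normal hS.normal
  have hM := powKernel_normal hS.comm e
  have herr : ∀ i ∈ t.leaves, i ≠ l →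
      t.subgroup (update (fun j => closure (T j)) i ⁅closure (T i), closure (T l)⁆) ≤
        powKernel (t.subgroup N) hS.comm e := by
    intro i _ hil
    have hA := IsAdmissible.update hS hT i (hKn l)
    rw [hT.subgroup_update i (hKn l)]
    refine fun y hy => ⟨hS.subgroup_closure_le hA hy, ?_⟩
    by_cases hiQ : i ∈ Q
    · by_cases hiP : i ∈ P
      · have : y ^ e₁ = 1 := by
          refine h₁ G t N S _ Q {i} hS hA hQ (by simpa using hiQ) (by simp) (fun j hj => ?_) y hy
          obtain rfl := Finset.mem_singleton.1 hj
          rw [update_self]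
          rintro _ ⟨s, hs, z, hz, rfl⟩
          exact commutator_mem_commutator (hPT j hiP hs) (hKl hz)
        rw [he, mul_assoc, pow_mul, this, one_pow]
      · have : y ^ e₂ = 1 := by
          refine h₂ G t N S _ Q (insert i P) hS hA hQ (Finset.insert_subset hiQ hPQ)
            (by rw [Finset.card_insert_of_notMem hiP, hP]) (fun j hj => ?_) y hy
          rcases eq_or_ne j i with rfl | hj'
          · rw [update_self]
            rintro _ ⟨s, hs, z, hz, rfl⟩
            exact commutator_le_right ⊤ _ (commutator_mem_commutator (mem_top s) (hKl hz))
          · rw [update_of_ne hj']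
            exact hPT j ((Finset.mem_insert.1 hj).resolve_left hj')
        rw [he, mul_comm e₁, mul_assoc, pow_mul, this, one_pow]
    · have : y ^ e₃ = 1 := by
        refine h₃ G t N S _ (insert i Q) {i} hS hA
          (by rw [Finset.card_insert_of_notMem hiQ, hQ]) (by simp) (by simp) (fun j hj => ?_) y hy
        obtain rfl := Finset.mem_singleton.1 hj
        rw [update_self]
        rintro _ ⟨s, hs, z, hz, rfl⟩
        exact commutator_le_interOf_insert hS.normal Q j
          (commutator_mem_commutator (hS.closure_le hT j (subset_closure hs))
            (derivedSubgroup_antitone (interOf N Q) c.zero_le (hKl hz)))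
      rw [he, mul_comm, pow_mul, this, one_pow]
  have hval : ∀ v ∈ t.values T, v ^ ((∏ i, n i) * μ.factorial * e) = 1 := by
    intro v hv
    obtain ⟨g, hg, rfl⟩ := exists_eval_eq_of_mem_values (fun i => ⟨1, hT.one_mem i⟩) hS.linear hv
    obtain ⟨hfin, hcard⟩ := hS.finite_values k
    -- The exponent is a multiple of `n l` so that the new entry is an `n l`-th power of an element
    -- of `N l`, hence in `S l` whatever `a` is.
    have hmem (a : ℕ) : t.eval (update g l (g l ^ (n l * a))) ∈
        t.values fun i => quotientsOf^[k] (S i) := by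
      refine eval_mem_values (fun i => ?_) t
      rcases eq_or_ne i l with rfl | hi
      · rw [update_self, mul_comm, pow_mul]
        exact subset_iterate_quotients (hS.one_mem i) k (hS.pow_mem i _
          ((N i).pow_mem (hS.closure_le hT i (subset_closure (hg i))) a))
      · rw [update_of_ne hi]
        exact hT.subset i (hg i)
    obtain ⟨a, b, hab, hbμ, heq⟩ : ∃ a b, a < b ∧ b ≤ μ ∧
        t.eval (update g l (g l ^ (n l * a))) = t.eval (update g l (g l ^ (n l * b))) := by
      obtain ⟨a, ha, b, hb, hne, heq⟩ := Finset.exists_ne_map_eq_of_card_lt_of_maps_to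
        (s := Finset.range (μ + 1)) (t := hfin.toFinset)
        (f := fun a => t.eval (update g l (g l ^ (n l * a))))
        (by rw [Finset.card_range, ← Set.ncard_eq_toFinset_card _ hfin]; omega)
        (fun a _ => by simpa using hmem a)
      rw [Finset.mem_range] at ha hb
      rcases lt_or_gt_of_ne hne with hlt | hlt
      · exact ⟨a, b, hlt, by omega, heq⟩
      · exact ⟨b, a, hlt, by omega, heq.symm⟩
    have hpow := mk_eval_update_pow hKn (fun i => subset_closure (hg i)) hS.linear hl
      (powKernel (t.subgroup N) hS.comm e) herr
    have hquot : t.eval g ^ (n l * (b - a)) ∈ powKernel (t.subgroup N) hS.comm e := by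
      rw [← QuotientGroup.eq_one_iff, QuotientGroup.mk_pow]
      have h := (hpow (n l * a)).symm.trans ((congrArg _ heq).trans (hpow (n l * b)))
      rw [← Nat.add_sub_cancel' hab.le, mul_add, pow_add] at h
      simpa using h
    -- `l`, `a` and `b` depend on the group and the value; the product and the factorial are
    -- multiples of `n l` and `b - a` that do not.
    obtain ⟨d₁, hd₁⟩ : n l ∣ ∏ i, n i := Finset.dvd_prod_of_mem n (Finset.mem_univ l)
    obtain ⟨d₂, hd₂⟩ : b - a ∣ μ.factorial := Nat.dvd_factorial (by omega) (by omega)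
    rw [hd₁, hd₂, show n l * d₁ * ((b - a) * d₂) * e = n l * (b - a) * e * (d₁ * d₂) by ring,
      pow_mul _ _ (d₁ * d₂), pow_mul _ _ e, hquot.2, one_pow]
  intro x hx
  have hle : t.subgroup (fun i => closure (T i)) ≤
      powKernel (t.subgroup N) hS.comm ((∏ i, n i) * μ.factorial * e) := by
    rw [subgroup_closure hT.isNormalSubset]
    refine (Subgroup.closure_le _).2 fun v hv => ⟨hS.subgroup_closure_le hT ?_, hval v hv⟩
    rw [subgroup_closure hT.isNormalSubset]
    exact subset_closure hv
  exact (hle hx).2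

/-- Nested induction on `q`, then `c`, then `p`, each increasing towards its bound. The depth `k`
may grow freely: it affects only the size of the exponent. -/
theorem exists_annihilates (hn : ∀ i, 0 < n i) (q c k : ℕ) :
    ∃ e, 0 < e ∧ Annihilates.{u} m n q c 1 k e := by
  by_cases hm : m = 0
  · refine ⟨1, one_pos, fun G _ t N S T Q P hS => ?_⟩
    have h0 := hS.ncard_le
    rw [hm, Nat.le_zero, Set.ncard_eq_zero hS.finite] at h0
    exact absurd (eval_mem_values hS.one_mem t) (by simp [h0])
  obtain ⟨d, hd⟩ : ∃ d, Fintype.card X + 1 ≤ q + d := ⟨Fintype.card X + 1, by omega⟩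
  induction d generalizing q c k with
  | zero =>
    refine ⟨1, one_pos, fun G _ t N S T Q P _ _ hQ => ?_⟩
    have := Q.card_le_univ
    omega
  | succ d ihq =>
    obtain ⟨d', hd'⟩ : ∃ d', Fintype.card X ≤ c + d' := ⟨Fintype.card X, by omega⟩
    induction d' generalizing c k with
    | zero =>
      obtain ⟨e, he, h⟩ := ihq (q + 1) 0 1 (by omega)
      exact ⟨e, he, annihilates_of_card_le hd' h⟩
    | succ d' ihc =>
      -- Here `b` measures the distance to p > q, where P ⊆ Q is impossible.
      suffices H : ∀ b p k, 1 ≤ p → q + 1 ≤ p + b →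
          ∃ e, 0 < e ∧ Annihilates.{u} m n q c p k e from H q 1 k le_rfl (by omega)
      intro b
      induction b with
      | zero =>
        refine fun p k _ hb => ⟨1, one_pos, fun G _ t N S T Q P _ _ hQ hPQ hP => ?_⟩
        have := Finset.card_le_card hPQ
        omega
      | succ b ihp =>
        intro p k hp hb
        obtain ⟨e₁, he₁, h₁⟩ := ihc (c + 1) (k + 1) (by omega)
        obtain ⟨e₂, he₂, h₂⟩ := ihp (p + 1) (k + 1) (by omega) (by omega)
        obtain ⟨e₃, he₃, h₃⟩ := ihq (q + 1) 0 (k + 1) (by omega)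
        refine ⟨_, ?_, annihilates_step hp h₁ h₂ h₃⟩
        have := Finset.prod_pos fun i (_ : i ∈ Finset.univ) => hn i
        have := Nat.factorial_pos (m ^ 2 ^ (Fintype.card X * k))
        positivity

/-- An iterated commutator of normal subgroups that is abelian has bounded exponent. -/
theorem exists_pow_eq_one (m : ℕ) (hn : ∀ i, 0 < n i) : ∃ e, 0 < e ∧
    ∀ (G : Type u) [Group G] (t : CommutatorTree X) (N : X → Subgroup G) (S : X → Set G),
      AbelianSetting t m n N S → ∀ x ∈ t.subgroup N, x ^ e = 1 := by
  obtain ⟨e, he, h⟩ := exists_annihilates.{u} (m := m) hn 1 0 0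
  refine ⟨e, he, fun G _ t N S hS x hx => ?_⟩
  obtain ⟨l, -⟩ := t.leaves_nonempty
  refine h G t N S S {l} {l} hS (hS.isAdmissible 0) (by simp) subset_rfl (by simp)
    (fun j hj => ?_) x (by simpa only [← hS.closure_eq] using hx)
  obtain rfl := Finset.mem_singleton.1 hj
  exact (hS.subset j).trans (le_interOf_iff.2 fun i hi => by rw [Finset.mem_singleton.1 hi])

end CommutatorTree

/-! ### From bounded exponent to bounded order, and from words to trees -/

section

variable {G : Type*} [Group G]

/-- Elements acting alike on `V` by conjugation differ by a central element, so a commutator is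
determined by a pair of self-maps of `V`. -/
theorem card_commutatorSet_closure_le {V : Set G} (hfin : V.Finite) (hV : IsNormalSubset V) :
    Finite (commutatorSet (closure V)) ∧
      Nat.card (commutatorSet (closure V)) ≤ (V.ncard ^ V.ncard) ^ 2 := by
  have : Finite V := hfin
  let f : closure V → V → V := fun w v => ⟨w * v * (w : G)⁻¹, hV v v.2 w⟩
  have hf {a b : closure V} (h : f a = f b) : a⁻¹ * b ∈ center (closure V) := by
    have hc : (a : G)⁻¹ * b ∈ centralizer (closure V : Set G) := by
      rw [centralizer_closure, mem_centralizer_iff]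
      refine fun v hv => ?_
      have h1 : (a : G) * v * (a : G)⁻¹ = b * v * (b : G)⁻¹ :=
        congrArg Subtype.val (congrFun h ⟨v, hv⟩)
      symm
      calc (a : G)⁻¹ * b * v = (a : G)⁻¹ * (b * v * (b : G)⁻¹) * b := by group
        _ = v * ((a : G)⁻¹ * b) := by rw [← h1]; group
    exact mem_center_iff.2 fun w => Subtype.ext (mem_centralizer_iff.1 hc w w.2)
  have hcomm {a a' b b' : closure V} (ha : f a = f a') (hb : f b = f b') : ⁅a, b⁆ = ⁅a', b'⁆ := by
    obtain ⟨z, hz, rfl⟩ : ∃ z ∈ center (closure V), a' = a * z := ⟨_, hf ha, by group⟩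
    obtain ⟨y, hy, rfl⟩ : ∃ y ∈ center (closure V), b' = b * y := ⟨_, hf hb, by group⟩
    rw [mem_center_iff] at hz hy
    have hz' : ∀ g : closure V, ⁅z, g⁆ = 1 := fun g => commutatorElement_eq_one_iff_mul_comm.2 (hz g).symm
    have hy' : ∀ g : closure V, ⁅g, y⁆ = 1 := fun g => commutatorElement_eq_one_iff_mul_comm.2 (hy g)
    rw [commutatorElement_mul_left_eq_conj_mul, hz', commutatorElement_mul_right_eq_mul_conj, hy']
    group
  choose p q hpq using fun c : commutatorSet (closure V) => c.2
  have hinj : Injective fun c => (f (p c), f (q c)) := fun c d h => by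
    simp only [Prod.mk.injEq] at h
    exact Subtype.ext ((hpq c).symm.trans ((hcomm h.1 h.2).trans (hpq d)))
  refine ⟨Finite.of_injective _ hinj, (Nat.card_le_card_of_injective _ hinj).trans_eq ?_⟩
  rw [Nat.card_prod, Nat.card_fun, Nat.card_coe_set_eq, sq]

/-- A bound for the order of a group that is generated by a normal set of `m` elements and has an
abelianization of exponent `e`. -/
def cardClosureBound (m e : ℕ) : ℕ :=
  e ^ m * ∑ j ∈ Finset.range ((m ^ m) ^ 2 + 1), cardCommutatorBound j

theorem card_closure_le {V : Set G} (hfin : V.Finite) (hV : IsNormalSubset V) {e : ℕ} (he : 0 < e)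
    (h : ∀ x ∈ closure V, x ^ e ∈ ⁅closure V, closure V⁆) :
    Finite (closure V) ∧ Nat.card (closure V) ≤ cardClosureBound V.ncard e := by
  obtain ⟨hcf, hcc⟩ := card_commutatorSet_closure_le hfin hV
  have : Finite V := hfin
  have hfg : Group.FG (closure V) := Group.closure_finite_fg V
  have hsurj : Surjective (Abelianization.of (G := closure V)) :=
    QuotientGroup.mk_surjective
  have hpow (x : Abelianization (closure V)) : x ^ e = 1 := by
    obtain ⟨x, rfl⟩ := hsurj x
    rw [← map_pow, ← MonoidHom.mem_ker, Abelianization.ker_of]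
    have := h x x.2
    rw [← map_subtype_commutator] at this
    obtain ⟨y, hy, hyx⟩ := this
    rwa [← show y = x ^ e from Subtype.ext hyx]
  have hfg' : Group.FG (Abelianization (closure V)) := Group.fg_of_surjective hsurj
  have hrank : Group.rank (Abelianization (closure V)) ≤ V.ncard :=
    (Group.rank_le_of_surjective _ hsurj).trans
      ((rank_closure_finite_le_nat_card V).trans_eq (Nat.card_coe_set_eq V))
  have hdvd := (card_dvd_exponent_pow_rank' (Abelianization (closure V)) hpow).trans
    (pow_dvd_pow e hrank)
  have hpos : 0 < e ^ V.ncard := pow_pos he _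
  have hcard : Nat.card (closure V) = Nat.card (Abelianization (closure V)) *
      Nat.card (_root_.commutator (closure V)) := card_eq_card_quotient_mul_card_subgroup _
  constructor
  · refine Nat.finite_of_card_ne_zero ?_
    rw [hcard]
    exact mul_ne_zero (ne_zero_of_dvd_ne_zero hpos.ne' hdvd) Nat.card_pos.ne'
  · rw [hcard]
    refine Nat.mul_le_mul (Nat.le_of_dvd hpos hdvd) ?_
    refine (card_commutator_le_of_finite_commutatorSet _).trans ?_
    -- Only an upper bound for the number of commutators is known; summing over all possible numbers
    -- makes monotonicity of `cardCommutatorBound` unnecessary.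
    exact Finset.single_le_sum (f := cardCommutatorBound) (fun _ _ => Nat.zero_le _)
      (Finset.mem_range.2 (Nat.lt_succ_of_le hcc))

theorem IsOuterCommutatorWord.exists_tree {X : Type*} {V : Set X} {w : FreeGroup X}
    (h : IsOuterCommutatorWord V w) : ∃ t : CommutatorTree X, t.IsLinear ∧ t.leaves = V ∧
      ∀ (G : Type u) [Group G] (g : X → G), FreeGroup.lift g w = t.eval g := by
  induction h with
  | var x => exact ⟨.leaf x, trivial, rfl, fun G _ g => by simp [CommutatorTree.eval]⟩
  | comm _ _ hd iha ihb =>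
    obtain ⟨a, ha, rfl, hae⟩ := iha
    obtain ⟨b, hb, rfl, hbe⟩ := ihb
    refine ⟨.node a b, ⟨ha, hb, hd⟩, rfl, fun G _ g => ?_⟩
    simp [CommutatorTree.eval, commutatorElement_def, hae, hbe]

theorem wordValues_eq {X : Type*} {w : FreeGroup X} {t : CommutatorTree X} (ht : t.IsLinear)
    (hw : ∀ g : X → G, FreeGroup.lift g w = t.eval g) {T : X → Set G}
    (hT : ∀ i, (T i).Nonempty) : wordValues w T = t.values T := by
  ext v
  constructor
  · rintro ⟨g, hg, rfl⟩
    rw [hw]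
    exact CommutatorTree.eval_mem_values hg t
  · intro hv
    obtain ⟨g, hg, rfl⟩ := CommutatorTree.exists_eval_eq_of_mem_values hT ht hv
    exact ⟨g, hg, hw g⟩

end

/-- The iterated commutator of normal subgroups is finite of bounded order. -/
theorem CommutatorTree.exists_card_subgroup_le {X : Type*} [Fintype X] (m : ℕ) (n : X → ℕ) :
    ∃ b, ∀ (G : Type u) [Group G] (t : CommutatorTree X) (N : X → Subgroup G) (S : X → Set G),
      t.IsLinear → t.leaves = Set.univ → (∀ i, (N i).Normal) → (∀ i, N i = closure (S i)) →
        (∀ i, IsNormalSubset (S i)) → (∀ i, 0 < n i) → (∀ i, ∀ x ∈ N i, x ^ n i ∈ S i) →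
          (t.values S).Finite → (t.values S).ncard = m →
            Finite (t.subgroup N) ∧ Nat.card (t.subgroup N) ≤ b := by
  by_cases hn : ∀ i, 0 < n i
  swap
  · exact ⟨0, fun _ _ _ _ _ _ _ _ _ _ hn' => absurd hn' hn⟩
  obtain ⟨e, he, hpow⟩ := exists_pow_eq_one.{u} m hn
  refine ⟨cardClosureBound m e, fun G _ t N S ht htl hN hcl hS _ hp hfin hm => ?_⟩
  have hW : t.subgroup N = closure (t.values S) := by
    rw [← subgroup_closure hS]
    simp only [← hcl]
  have hWn := t.subgroup_normal hN
  -- All hypotheses pass to the quotient by `D`, where the iterated commutator becomes abelian; its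
  -- exponent there is what `card_closure_le` needs.
  let D := ⁅t.subgroup N, t.subgroup N⁆
  let φ := QuotientGroup.mk' D
  have hφ : Surjective φ := QuotientGroup.mk'_surjective D
  have hset : AbelianSetting t m n (fun i => (N i).map φ) (fun i => φ '' S i) :=
    { linear := ht
      leaves_eq := htl
      normal := fun i => (hN i).map _ hφ
      closure_eq := fun i => by rw [hcl i, MonoidHom.map_closure]
      isNormalSubset := by
        rintro i _ ⟨s, hs, rfl⟩ g
        obtain ⟨g, rfl⟩ := hφ g
        exact ⟨_, hS i s hs g, by simp⟩
      pos := hn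
      pow_mem := by
        rintro i _ ⟨x, hx, rfl⟩
        exact ⟨_, hp i x hx, map_pow φ x _⟩
      finite := by
        rw [← image_values]
        exact hfin.image _
      ncard_le := by
        rw [← image_values, ← hm]
        exact Set.ncard_image_le hfin
      comm := by
        rw [← map_subgroup]
        rintro _ ⟨x, hx, rfl⟩ _ ⟨y, hy, rfl⟩
        exact commute_mk_of_commutator_mem (commutator_mem_commutator hx hy) }
  have hD : ∀ x ∈ closure (t.values S), x ^ e ∈ ⁅closure (t.values S), closure (t.values S)⁆ := by
    rw [← hW]
    intro x hx
    rw [← QuotientGroup.eq_one_iff, QuotientGroup.mk_pow]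
    refine hpow _ t _ _ hset _ ?_
    rw [← map_subgroup]
    exact mem_map_of_mem φ hx
  rw [hW, ← hm]
  exact card_closure_le hfin (isNormalSubset_values hS t) he hD

end

theorem theorem1p2 :
    ∃ f : ℕ → (r : ℕ) → (Fin r → ℕ) → ℕ,
      ∀ (m r : ℕ) (n : Fin r → ℕ) (w : FreeGroup (Fin r)) (G : Type*) [Group G]
        (N : Fin r → Subgroup G) (S : Fin r → Set G),
        IsOuterCommutatorWord Set.univ w →
        (∀ i, (N i).Normal) →
        (∀ i, N i = Subgroup.closure (S i)) →
        (∀ i, IsNormalSubset (S i)) →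
        (∀ i, 0 < n i ∧ ∀ x ∈ N i, x ^ n i ∈ S i) →
        (wordValues w S).Finite →
        (wordValues w S).ncard = m →
          Finite (wordSubgroup w (fun i => (N i : Set G))) ∧
            Nat.card (wordSubgroup w (fun i => (N i : Set G))) ≤ f m r n := by
  choose f hf using fun (m r : ℕ) (n : Fin r → ℕ) => CommutatorTree.exists_card_subgroup_le m n
  refine ⟨f, fun m r n w G _ N S hw hN hcl hS hn hfin hm => ?_⟩
  obtain ⟨t, ht, htl, htw⟩ := hw.exists_tree
  have hSne (i : Fin r) : (S i).Nonempty := ⟨_, (hn i).2 1 (N i).one_mem⟩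
  have hNne (i : Fin r) : (N i : Set G).Nonempty := ⟨1, (N i).one_mem⟩
  rw [wordValues_eq ht (htw G) hSne] at hfin hm
  have hsub : wordSubgroup w (fun i => (N i : Set G)) = t.subgroup N := by
    rw [wordSubgroup, wordValues_eq ht (htw G) hNne,
      ← CommutatorTree.subgroup_closure fun i => (hN i).isNormalSubset]
    simp only [Subgroup.closure_eq]
  rw [hsub]
  exact hf m r n G t N S ht htl hN hcl hS (fun i => (hn i).1) (fun i => (hn i).2) hfin hm
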